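/- Let $1\le p\le\infty$, let $W_n, W\in L^p((0,1)^2)$ be real-valued with $\|W_n-W\|_\square\to 0$, where the cut norm is $$\|U\|_\square=\sup\Big\{\int_0^1\!\!\int_0^1 U(x,y)f(x)g(y)\,dx\,dy \;:\; f,g:(0,1)\to[-1,1]\text{ measurable}\Big\},$$ and let $u_n:(0,1)\to\mathbb R$ be measurable with $\sup_n\|u_n\|_{L^\infty}<\infty$. A Young measure is a measurable family $\nu=(\nu_x)_{x\in(0,1)}$ of probability measures on $\mathbb R$. The narrow topology on Young measures is the coarsest one for which $\nu\mapsto\int_0^1 g(x)\int_{\mathbb R} f\,d\nu_x\,dx$ is continuous for all $f\in C_b(\mathbb R)$ and $g\in L^1((0,1))$. Put $\nu^n=(\delta_{u_n(x)})_{x\in(0,1)}$, and let $$D^U(\nu)=\int_0^1\!\!\int_0^1 U(x,y)\int_{\mathbb R^2}|\lambda-\mu|^2\,d\nu_x(\lambda)\,d\nu_y(\mu)\,dx\,dy$$ be the graphon Dirichlet energy, so that $D^{W_n}(\nu^n)=\int_0^1\int_0^1 W_n(x,y)|u_n(x)-u_n(y)|^2\,dx\,dy$. Then: 1. The set $\{\nu^n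 : n\in\mathbb N\}$ is precompact in the narrow topology (its closure is compact), and every subsequence of $(\nu^n)$ has a narrowly convergent further subsequence. 2. All integrals defining the energies $D^{W_n}(\nu^n)$ converge absolutely. If a subsequence $(\nu^{n_k})$ converges narrowly to a Young measure $\nu$, then the integrals defining $D^W(\nu)$ converge absolutely, and $D^{W_{n_k}}(\nu^{n_k})\to D^W(\nu)$ as $k\to\infty$. 3. In particular, suppose that for every $n\ge1$ the function $u_n$ is a graph function on $n$ nodes, that is, it is constant (up to null sets) on each interval $[\frac{i-1}{n},\frac{i}{n})$, $1\le i\le n$. Then, along every such subsequence, the graph Dirichlet energies of $u_{n_k}$ converge to $D^W(\nu)$, where the graph Dirichlet energy of $u$ on $n$ nodes with kernel $W_n$ is $\int_0^1\int_0^1 W_n(x,y)|u(x)-u(y)|^2\,dx\,dy$ if $u$ is a graph function on $n$ nodes and $+\infty$ otherwise. -/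

import Mathlib

open MeasureTheory ProbabilityTheory Set Filter Topology
open scoped ENNReal BoundedContinuousFunction

noncomputable section

/-- The open unit interval `(0,1)`; it carries the restriction of Lebesgue measure as `volume`. -/
abbrev OpenUnit : Type := ↥(Ioo (0 : ℝ) 1)

instance OpenUnit.instMeasureSpace : MeasureSpace OpenUnit := Measure.Subtype.measureSpace

instance OpenUnit.isProbabilityMeasure_volume :
    IsProbabilityMeasure (volume : Measure OpenUnit) := by
  constructor
  rw [Measure.Subtype.volume_univ measurableSet_Ioo.nullMeasurableSet]
  simp

/-- The cut norm
`‖W‖_□ = sup { ∫∫ W(x,y) f(x) g(y) dx dy : f, g : (0,1) → [-1,1] measurable }`.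
For integrable `W` the set is nonempty, bounded by the `L¹` norm, and symmetric about `0`. -/
def cutNorm (W : OpenUnit × OpenUnit → ℝ) : ℝ :=
  sSup {r : ℝ | ∃ f g : OpenUnit → ℝ, Measurable f ∧ Measurable g ∧
    (∀ x, f x ∈ Icc (-1 : ℝ) 1) ∧ (∀ x, g x ∈ Icc (-1 : ℝ) 1) ∧
    r = ∫ z : OpenUnit × OpenUnit, W z * f z.1 * g z.2}

/-- A Young measure on `(0,1) × ℝ`: a measurable family `(ν_x)` of probability measures on `ℝ`
indexed by `x ∈ (0,1)`. -/
structure YoungMeasure where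
  /-- The family `x ↦ ν_x`. -/
  kernel : Kernel OpenUnit ℝ
  /-- Every `ν_x` is a probability measure. -/
  isMarkov : IsMarkovKernel kernel

/-- The Young measure `(δ_{u(x)})` corresponding to a measurable function `u`. -/
def YoungMeasure.ofFun (u : OpenUnit → ℝ) (hu : Measurable u) : YoungMeasure where
  kernel := Kernel.deterministic u hu
  isMarkov := Kernel.isMarkovKernel_deterministic hu

/-- The duality pairing `∫₀¹ g(x) ∫ f(l) dν_x(l) dx` of `x ↦ ∫ f dν_x` in `L^∞((0,1))` with
`g ∈ L¹((0,1))`. -/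
def YoungMeasure.pairing (ν : YoungMeasure)
    (f : ℝ →ᵇ ℝ) (g : {g : OpenUnit → ℝ // Integrable g volume}) : ℝ :=
  ∫ x : OpenUnit, (∫ l, f l ∂(ν.kernel x)) * g.1 x

/-- The narrow topology on Young measures: the coarsest topology for which, for every
`f ∈ C_b(ℝ)`, the map `ν ↦ (x ↦ ∫ f dν_x)` is continuous into `L^∞((0,1))` with its weak-*
topology. (Families that agree for almost every `x` are inseparable in it.) -/
instance YoungMeasure.instTopologicalSpace : TopologicalSpace YoungMeasure :=
  TopologicalSpace.induced
    (fun ν (q : (ℝ →ᵇ ℝ) × {g : OpenUnit → ℝ // Integrable g volume}) => ν.pairing q.1 q.2)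
    inferInstance

/-- Convergence in the narrow topology is narrow convergence: `∫ f dν^n_x` converges to
`∫ f dν_x` weakly-* in `L^∞((0,1))` for every `f ∈ C_b(ℝ)`. -/
theorem YoungMeasure.tendsto_iff {ι : Type*} {l : Filter ι} (ν : ι → YoungMeasure)
    (ν' : YoungMeasure) :
    Tendsto ν l (𝓝 ν') ↔ ∀ (f : ℝ →ᵇ ℝ) (g : OpenUnit → ℝ), Integrable g volume →
      Tendsto (fun i => ∫ x : OpenUnit, (∫ l, f l ∂((ν i).kernel x)) * g x) l
        (𝓝 (∫ x : OpenUnit, (∫ l, f l ∂(ν'.kernel x)) * g x)) := by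
  rw [nhds_induced, tendsto_comap_iff, tendsto_pi_nhds]
  exact ⟨fun h f g hg => h (f, ⟨g, hg⟩), fun h q => h q.1 q.2.1 q.2.2⟩

/-- The inner integral `∫_{ℝ²} |l - m|² dν_x(l) dν_y(m)` at `z = (x, y)`. -/
def dirichletDensity (ν : YoungMeasure) (z : OpenUnit × OpenUnit) : ℝ :=
  ∫ q : ℝ × ℝ, |q.1 - q.2| ^ 2 ∂((ν.kernel z.1).prod (ν.kernel z.2))

/-- The graphon Dirichlet energy
`D^W(ν) = ∫∫ W(x,y) ∫_{ℝ²} |l - m|² dν_x(l) dν_y(m) dx dy`. -/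
def graphonDirichlet (W : OpenUnit × OpenUnit → ℝ) (ν : YoungMeasure) : ℝ :=
  ∫ z : OpenUnit × OpenUnit, W z * dirichletDensity ν z

/-- All integrals in the definition of `D^W(ν)` converge absolutely, so that `D^W(ν)` is a
well-defined real number. -/
def DirichletIntegrable (W : OpenUnit × OpenUnit → ℝ) (ν : YoungMeasure) : Prop :=
  (∀ᵐ z : OpenUnit × OpenUnit, Integrable (fun q : ℝ × ℝ => |q.1 - q.2| ^ 2)
    ((ν.kernel z.1).prod (ν.kernel z.2))) ∧
  Integrable (fun z : OpenUnit × OpenUnit => W z * dirichletDensity ν z) volume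

/-- The space `V^n` of functions on `n`-node graphs, as functions on `(0,1)` that are (up to null
sets) constant on each of the intervals `[i/n, (i+1)/n)`, `i = 0, …, n - 1`. -/
def graphFunctions (n : ℕ) : Set (OpenUnit → ℝ) :=
  {u | ∃ c : Fin n → ℝ, ∀ᵐ x : OpenUnit, ∀ i : Fin n,
    (x : ℝ) ∈ Ico ((i : ℝ) / n) (((i : ℝ) + 1) / n) → u x = c i}

open Classical in
/-- The graph Dirichlet energy: `∫∫ W(x,y) |u(x) - u(y)|² dx dy` for `u ∈ V^n`, and `+∞`
otherwise. -/
def graphDirichlet (n : ℕ) (W : OpenUnit × OpenUnit → ℝ) (u : OpenUnit → ℝ) : EReal :=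
  if u ∈ graphFunctions n then
    ((∫ z : OpenUnit × OpenUnit, W z * |u z.1 - u z.2| ^ 2 : ℝ) : EReal)
  else ⊤

end

-- Only integrability of the kernels matters: on a probability space `L^p` embeds in `L^1`. The
-- uniform bound on `u_n` puts every Young measure on a fixed `[-M, M]`. Compactness comes from
-- Prokhorov's theorem for the joint laws `ν_x(dl) dx`, whose first marginal is always Lebesgue
-- measure; disintegration carries limits back to Young measures. For the energies, expanding `|l -
-- m|²` turns `D^U(ν)` into three bilinear forms `∫∫ U f g` in the first and second moments of `ν_x`
-- (`YoungMeasure.dirichlet_eq_kernelForm`). Narrow convergence makes these moments converge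
-- weakly-*. Replacing `W_n` by `W` costs at most a constant times the cut norm, and for fixed
-- integrable `W` the form is sequentially continuous under bounded weak-* convergence of both
-- arguments (`BoundedWeakStarTendsto.tendsto_kernelForm`).

attribute [instance] YoungMeasure.isMarkov

/-! ### Narrow compactness through joint laws -/

/-- The probability measure `ν_x(dl) dx` on `(0,1) × ℝ` defined by a Young measure. -/
noncomputable def YoungMeasure.joint (ν : YoungMeasure) : ProbabilityMeasure (OpenUnit × ℝ) :=
  ⟨(volume : Measure OpenUnit) ⊗ₘ ν.kernel, inferInstance⟩

/-- The Young measure obtained by disintegrating a probability measure on `(0,1) × ℝ`. -/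
noncomputable def YoungMeasure.ofJoint (π : ProbabilityMeasure (OpenUnit × ℝ)) : YoungMeasure where
  kernel := (π : Measure (OpenUnit × ℝ)).condKernel
  isMarkov := inferInstance

theorem YoungMeasure.joint_ofJoint {π : ProbabilityMeasure (OpenUnit × ℝ)}
    (hπ : (π : Measure (OpenUnit × ℝ)).fst = volume) : (ofJoint π).joint = π := by
  apply Subtype.ext
  change (volume : Measure OpenUnit) ⊗ₘ (π : Measure (OpenUnit × ℝ)).condKernel = π
  rw [← hπ]
  exact Measure.disintegrate _ _

theorem YoungMeasure.fst_joint (ν : YoungMeasure) :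
    (ν.joint : Measure (OpenUnit × ℝ)).fst = volume :=
  Measure.fst_compProd _ _

theorem integrable_mul_of_fst_eq {π : Measure (OpenUnit × ℝ)} (hπ : π.fst = volume) (f : ℝ →ᵇ ℝ)
    {g : OpenUnit → ℝ} (hg : Integrable g volume) :
    Integrable (fun z : OpenUnit × ℝ => f z.2 * g z.1) π := by
  have h1 : Integrable (fun z : OpenUnit × ℝ => g z.1) π := by
    rw [← hπ] at hg
    exact hg.comp_measurable measurable_fst
  exact h1.bdd_mul (c := ‖f‖) (by fun_prop) (Eventually.of_forall fun z => f.norm_coe_le_norm _)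

theorem YoungMeasure.pairing_eq_integral_joint (ν : YoungMeasure) (f : ℝ →ᵇ ℝ)
    (g : {g : OpenUnit → ℝ // Integrable g volume}) :
    ν.pairing f g = ∫ z, f z.2 * g.1 z.1 ∂(ν.joint : Measure (OpenUnit × ℝ)) := by
  have := Measure.integral_compProd (integrable_mul_of_fst_eq ν.fst_joint f g.2)
  change _ = ∫ z, _ ∂((volume : Measure OpenUnit) ⊗ₘ ν.kernel)
  rw [this]
  simp only [YoungMeasure.pairing, integral_mul_const]

theorem YoungMeasure.isInducing_pairing : IsInducing
    (fun (ν : YoungMeasure) (q : (ℝ →ᵇ ℝ) × {g : OpenUnit → ℝ // Integrable g volume}) =>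
      ν.pairing q.1 q.2) := ⟨rfl⟩

/-- The narrow topology is not Hausdorff, since a.e. equal families are inseparable. Being induced
from a product of real lines it is regular, and R1 suffices for closures of compact sets to be
compact. -/
instance : R1Space YoungMeasure :=
  have := YoungMeasure.isInducing_pairing.regularSpace
  inferInstance

theorem YoungMeasure.inseparable_of_joint_eq {ν ν' : YoungMeasure} (h : ν.joint = ν'.joint) :
    Inseparable ν ν' := by
  refine isInducing_pairing.inseparable_iff.1 (Inseparable.of_eq ?_)
  funext q
  simp only [pairing_eq_integral_joint, h]

/-- Weak convergence only tests continuous functions, so `g` is approximated in `L^1` by a bounded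
continuous `g'`. The error is uniform in `π` because the first marginal is fixed. -/
theorem continuousOn_integral_mul_of_fst_eq (f : ℝ →ᵇ ℝ) {g : OpenUnit → ℝ}
    (hg : Integrable g volume) :
    ContinuousOn (fun π : ProbabilityMeasure (OpenUnit × ℝ) =>
      ∫ z, f z.2 * g z.1 ∂(π : Measure (OpenUnit × ℝ)))
      {π | (π : Measure (OpenUnit × ℝ)).fst = volume} := by
  apply continuousOn_of_uniform_approx_of_continuousOn
  intro U hU
  obtain ⟨ε, hε, hεU⟩ := Metric.mem_uniformity_dist.1 hU
  -- The `+ 1` covers `f = 0`, and with the factor 2 makes the final bound strict.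
  obtain ⟨g', hg', hg'i⟩ := hg.exists_boundedContinuous_integral_sub_le
    (ε := ε / (2 * (‖f‖ + 1))) (by positivity)
  let F : (OpenUnit × ℝ) →ᵇ ℝ :=
    f.compContinuous ⟨Prod.snd, continuous_snd⟩ * g'.compContinuous ⟨Prod.fst, continuous_fst⟩
  refine ⟨fun π => ∫ z, F z ∂(π : Measure (OpenUnit × ℝ)),
    (ProbabilityMeasure.continuous_integral_boundedContinuousFunction F).continuousOn,
    fun π hπ => hεU ?_⟩
  have hπ' : (π : Measure (OpenUnit × ℝ)).fst = volume := hπ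
  have hn : Integrable (fun z : OpenUnit × ℝ => ‖g z.1 - g' z.1‖) (π : Measure (OpenUnit × ℝ)) := by
    have h := (hg.sub hg'i).norm
    rw [← hπ'] at h
    exact h.comp_measurable measurable_fst
  have hn' : ∫ z : OpenUnit × ℝ, ‖g z.1 - g' z.1‖ ∂(π : Measure (OpenUnit × ℝ))
      = ∫ x, ‖g x - g' x‖ := by
    rw [← hπ', Measure.fst, integral_map measurable_fst.aemeasurable]
    have h := (hg.sub hg'i).norm.aestronglyMeasurable
    rw [← hπ'] at h
    exact h
  rw [Real.dist_eq, ← Real.norm_eq_abs]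
  calc ‖(∫ z, f z.2 * g z.1 ∂(π : Measure (OpenUnit × ℝ))) - ∫ z, F z ∂(π : Measure _)‖
      = ‖∫ z, f z.2 * (g - g') z.1 ∂(π : Measure (OpenUnit × ℝ))‖ := by
        simp only [Pi.sub_apply, mul_sub]
        rw [integral_sub (integrable_mul_of_fst_eq hπ' f hg) (integrable_mul_of_fst_eq hπ' f hg'i)]
        rfl
    _ ≤ ∫ z, ‖f‖ * ‖g z.1 - g' z.1‖ ∂(π : Measure (OpenUnit × ℝ)) := by
        refine norm_integral_le_of_norm_le (hn.const_mul _) (Eventually.of_forall fun z => ?_)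
        rw [norm_mul]
        gcongr
        · exact f.norm_coe_le_norm _
        · rfl
    _ = ‖f‖ * ∫ x, ‖g x - g' x‖ := by rw [integral_const_mul, hn']
    _ ≤ ‖f‖ * (ε / (2 * (‖f‖ + 1))) := by gcongr
    _ < ε := by
        rw [mul_div_assoc', div_lt_iff₀ (by positivity)]
        nlinarith [norm_nonneg f]

theorem YoungMeasure.continuousOn_ofJoint :
    ContinuousOn ofJoint {π | (π : Measure (OpenUnit × ℝ)).fst = volume} := by
  rw [isInducing_pairing.continuousOn_iff, continuousOn_pi]
  intro q
  refine (continuousOn_integral_mul_of_fst_eq q.1 q.2.2).congr fun π hπ => ?_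
  simp only [Function.comp_apply, pairing_eq_integral_joint, joint_ofJoint hπ]

theorem isClosed_setOf_fst_eq_volume :
    IsClosed {π : ProbabilityMeasure (OpenUnit × ℝ) |
      (π : Measure (OpenUnit × ℝ)).fst = volume} := by
  let P : ProbabilityMeasure OpenUnit := ⟨volume, inferInstance⟩
  have h : {π : ProbabilityMeasure (OpenUnit × ℝ) | (π : Measure (OpenUnit × ℝ)).fst = volume} =
      (fun π => ProbabilityMeasure.map π measurable_fst.aemeasurable) ⁻¹' {P} := by
    ext π
    exact (Subtype.ext_iff (a1 := ProbabilityMeasure.map π measurable_fst.aemeasurable)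
      (a2 := P)).symm
  rw [h]
  exact isClosed_singleton.preimage (ProbabilityMeasure.continuous_map continuous_fst)

/-- Tightness holds marginal by marginal: the first marginal is one fixed measure on a Polish space,
the second lives on `K`. -/
theorem YoungMeasure.isCompact_closure_joint {ι : Type*} {ν : ι → YoungMeasure} {K : Set ℝ}
    (hK : IsCompact K) (hν : ∀ i, ∀ᵐ x, (ν i).kernel x Kᶜ = 0) :
    IsCompact (closure (range fun i => (ν i).joint)) := by
  apply isCompact_closure_of_isTightMeasureSet
  apply IsTightMeasureSet.prodMk
  · have : PolishSpace OpenUnit := isOpen_Ioo.polishSpace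
    refine (isTightMeasureSet_singleton (μ := (volume : Measure OpenUnit))).subset ?_
    rintro _ ⟨_, ⟨_, ⟨i, rfl⟩, rfl⟩, rfl⟩
    exact (ν i).fst_joint
  · rw [isTightMeasureSet_iff_exists_isCompact_measure_compl_le]
    refine fun ε _ => ⟨K, hK, ?_⟩
    rintro _ ⟨_, ⟨_, ⟨i, rfl⟩, rfl⟩, rfl⟩
    rw [Measure.snd_apply hK.measurableSet.compl]
    refine le_of_eq_of_le ?_ zero_le
    change ((volume : Measure OpenUnit) ⊗ₘ (ν i).kernel) _ = 0
    rw [Measure.compProd_apply (measurable_snd hK.measurableSet.compl)]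
    exact lintegral_eq_zero_of_ae_eq_zero (hν i)

theorem YoungMeasure.closure_joint_subset {ι : Type*} (ν : ι → YoungMeasure) :
    closure (range fun i => (ν i).joint) ⊆ {π | (π : Measure (OpenUnit × ℝ)).fst = volume} :=
  closure_minimal (range_subset_iff.2 fun i => (ν i).fst_joint) isClosed_setOf_fst_eq_volume

theorem YoungMeasure.inseparable_ofJoint_joint (ν : YoungMeasure) :
    Inseparable (ofJoint ν.joint) ν :=
  inseparable_of_joint_eq (joint_ofJoint ν.fst_joint)

theorem YoungMeasure.isCompact_closure_range {ι : Type*} {ν : ι → YoungMeasure} {K : Set ℝ}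
    (hK : IsCompact K) (hν : ∀ i, ∀ᵐ x, (ν i).kernel x Kᶜ = 0) :
    IsCompact (closure (range ν)) := by
  have hc := ((isCompact_closure_joint hK hν).image_of_continuousOn
    (continuousOn_ofJoint.mono (closure_joint_subset ν))).closure
  refine hc.closure_of_subset (range_subset_iff.2 fun i => ?_)
  -- Disintegrating the joint law recovers `ν i` only up to inseparability, which closed sets cannot
  -- detect.
  rw [← (inseparable_ofJoint_joint (ν i)).mem_closed_iff isClosed_closure]
  exact subset_closure ⟨_, subset_closure ⟨i, rfl⟩, rfl⟩

/-- The subsequence is extracted among the joint laws, where compactness is sequential, and then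
pushed through `ofJoint`. -/
theorem YoungMeasure.exists_tendsto_subseq {ν : ℕ → YoungMeasure} {K : Set ℝ}
    (hK : IsCompact K) (hν : ∀ i, ∀ᵐ x, (ν i).kernel x Kᶜ = 0) :
    ∃ ψ : ℕ → ℕ, StrictMono ψ ∧ ∃ ν', Tendsto (fun k => ν (ψ k)) atTop (𝓝 ν') := by
  obtain ⟨π, hπ, ψ, hψ, hlim⟩ := (isCompact_closure_joint hK hν).tendsto_subseq
    (x := fun i => (ν i).joint) fun i => subset_closure ⟨i, rfl⟩
  refine ⟨ψ, hψ, ofJoint π, ?_⟩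
  have h := (continuousOn_ofJoint π (closure_joint_subset ν hπ)).tendsto.comp
    (tendsto_nhdsWithin_iff.2 ⟨hlim, Eventually.of_forall fun k => (ν (ψ k)).fst_joint⟩)
  rw [isInducing_pairing.tendsto_nhds_iff] at h ⊢
  refine h.congr fun k => ?_
  funext q
  simp only [Function.comp_apply, pairing_eq_integral_joint, joint_ofJoint (ν _).fst_joint]


/-! ### Bilinear forms, the cut norm and weak-* limits -/

/-- The bilinear form `∫∫ U(x,y) f(x) g(y) dx dy`. -/
noncomputable def kernelForm (U : OpenUnit × OpenUnit → ℝ) (f g : OpenUnit → ℝ) : ℝ :=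
  ∫ z : OpenUnit × OpenUnit, U z * f z.1 * g z.2

theorem integrable_kernelForm {U : OpenUnit × OpenUnit → ℝ} (hU : Integrable U volume)
    {f g : OpenUnit → ℝ} (hf : Measurable f) (hg : Measurable g) {A : ℝ}
    (hfA : ∀ x, |f x| ≤ A) (hgA : ∀ x, |g x| ≤ A) :
    Integrable (fun z : OpenUnit × OpenUnit => U z * f z.1 * g z.2) volume := by
  have hf' : Measurable fun z : OpenUnit × OpenUnit => f z.1 := hf.comp measurable_fst
  have hg' : Measurable fun z : OpenUnit × OpenUnit => g z.2 := hg.comp measurable_snd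
  exact (hU.mul_bdd hf'.aestronglyMeasurable (Eventually.of_forall fun z => hfA z.1)).mul_bdd
    hg'.aestronglyMeasurable (Eventually.of_forall fun z => hgA z.2)

theorem kernelForm_le_cutNorm {U : OpenUnit × OpenUnit → ℝ} (hU : Integrable U volume)
    {f g : OpenUnit → ℝ} (hf : Measurable f) (hg : Measurable g)
    (hf1 : ∀ x, |f x| ≤ 1) (hg1 : ∀ x, |g x| ≤ 1) :
    kernelForm U f g ≤ cutNorm U := by
  refine le_csSup ⟨∫ z, ‖U z‖, ?_⟩
    ⟨f, g, hf, hg, fun x => abs_le.1 (hf1 x), fun x => abs_le.1 (hg1 x), rfl⟩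
  rintro _ ⟨f', g', -, -, hf', hg', rfl⟩
  refine (Real.le_norm_self _).trans
    (norm_integral_le_of_norm_le hU.norm (Eventually.of_forall ?_))
  intro z
  have h1 : ‖f' z.1‖ ≤ 1 := abs_le.2 (hf' z.1)
  have h2 : ‖g' z.2‖ ≤ 1 := abs_le.2 (hg' z.2)
  rw [norm_mul, norm_mul, mul_assoc]
  exact mul_le_of_le_one_right (norm_nonneg _) (mul_le_one₀ h1 (norm_nonneg _) h2)

theorem abs_kernelForm_le_cutNorm {U : OpenUnit × OpenUnit → ℝ} (hU : Integrable U volume)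
    {f g : OpenUnit → ℝ} (hf : Measurable f) (hg : Measurable g) {A : ℝ} (hA : 0 < A)
    (hfA : ∀ x, |f x| ≤ A) (hgA : ∀ x, |g x| ≤ A) :
    |kernelForm U f g| ≤ A ^ 2 * cutNorm U := by
  -- Dividing by `A` makes both functions admissible; the sign `s` is absorbed into `f` to bound the
  -- absolute value.
  have scale : ∀ s : ℝ, |s| = 1 → s * kernelForm U f g ≤ A ^ 2 * cutNorm U := by
    intro s hs
    have hb : ∀ t : ℝ, |t| ≤ A → |t / A| ≤ 1 := fun t ht => by
      rwa [abs_div, abs_of_pos hA, div_le_one hA]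
    have h := kernelForm_le_cutNorm hU (f := fun x => s * (f x / A)) (g := fun x => g x / A)
      ((hf.div_const A).const_mul s) (hg.div_const A)
      (fun x => by rw [abs_mul, hs, one_mul]; exact hb _ (hfA x)) (fun x => hb _ (hgA x))
    have e : kernelForm U (fun x => s * (f x / A)) (fun x => g x / A)
        = s / A ^ 2 * kernelForm U f g := by
      simp only [kernelForm]
      rw [← integral_const_mul]
      congr 1
      funext z
      field_simp
    rw [e] at h
    have := mul_le_mul_of_nonneg_left h (sq_nonneg A)
    rwa [← mul_assoc, mul_div_cancel₀ _ (by positivity)] at this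
  rw [abs_le']
  exact ⟨by simpa using scale 1 (by simp), by simpa using scale (-1) (by simp)⟩

/-- Weak-* convergence in `L^∞((0,1))` of uniformly bounded functions. -/
structure BoundedWeakStarTendsto (A : ℝ) (f : ℕ → OpenUnit → ℝ) (f' : OpenUnit → ℝ) : Prop where
  measurable : ∀ n, Measurable (f n)
  measurable_lim : Measurable f'
  bound : ∀ n x, |f n x| ≤ A
  bound_lim : ∀ x, |f' x| ≤ A
  tendsto : ∀ g : OpenUnit → ℝ, Integrable g volume →
    Tendsto (fun n => ∫ x, f n x * g x) atTop (𝓝 (∫ x, f' x * g x))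

theorem kernelForm_eq_integral_integral {U : OpenUnit × OpenUnit → ℝ} (hU : Integrable U volume)
    {f g : OpenUnit → ℝ} (hf : Measurable f) (hg : Measurable g) {A : ℝ}
    (hfA : ∀ x, |f x| ≤ A) (hgA : ∀ x, |g x| ≤ A) :
    kernelForm U f g = ∫ x, f x * ∫ y, g y * U (x, y) := by
  rw [kernelForm, Measure.volume_eq_prod,
    integral_prod _ (integrable_kernelForm hU hf hg hfA hgA)]
  congr 1
  funext x
  rw [← integral_const_mul]
  congr 1
  funext y
  ring

/-- Integrating against `U` is a compact operation: almost every slice `U (x, ·)` is integrable, so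
`∫ g_n(y) U(x,y) dy` converges pointwise a.e., and by domination in `L^1`. This strong limit can be
paired with the weak-* limit of `f_n`. -/
theorem BoundedWeakStarTendsto.tendsto_kernelForm {U : OpenUnit × OpenUnit → ℝ}
    (hU : Integrable U volume) {A : ℝ} {f g : ℕ → OpenUnit → ℝ} {f' g' : OpenUnit → ℝ}
    (hf : BoundedWeakStarTendsto A f f') (hg : BoundedWeakStarTendsto A g g') :
    Tendsto (fun n => kernelForm U (f n) (g n)) atTop (𝓝 (kernelForm U f' g')) := by
  have hUp : Integrable U ((volume : Measure OpenUnit).prod volume) := hU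
  have slice : ∀ {k : OpenUnit → ℝ}, Measurable k → (∀ x, |k x| ≤ A) →
      Integrable (fun x => ∫ y, k y * U (x, y)) volume := by
    intro k hk hkA
    have hk' : Measurable fun z : OpenUnit × OpenUnit => k z.2 := hk.comp measurable_snd
    exact (hUp.bdd_mul hk'.aestronglyMeasurable
      (Eventually.of_forall fun z => hkA z.2)).integral_prod_left
  have slice_bound : ∀ {k : OpenUnit → ℝ}, Measurable k → (∀ x, |k x| ≤ A) →
      ∀ᵐ x, ‖∫ y, k y * U (x, y)‖ ≤ A * ∫ y, ‖U (x, y)‖ := by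
    intro k hk hkA
    filter_upwards [hUp.prod_right_ae] with x hx
    rw [← integral_const_mul]
    refine norm_integral_le_of_norm_le (hx.norm.const_mul A) (Eventually.of_forall fun y => ?_)
    rw [norm_mul]
    exact mul_le_mul_of_nonneg_right (hkA y) (norm_nonneg _)
  have hpt : ∀ᵐ x, Tendsto (fun n => ∫ y, g n y * U (x, y)) atTop
      (𝓝 (∫ y, g' y * U (x, y))) := by
    filter_upwards [hUp.prod_right_ae] with x hx
    exact hg.tendsto _ hx
  have hsl := slice hg.measurable_lim hg.bound_lim
  have herr : Tendsto (fun n => ∫ x, f n x *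
      ((∫ y, g n y * U (x, y)) - ∫ y, g' y * U (x, y))) atTop (𝓝 0) := by
    rw [← integral_zero OpenUnit ℝ (μ := volume)]
    refine tendsto_integral_of_dominated_convergence
      (fun x => A * (2 * (A * ∫ y, ‖U (x, y)‖)))
      (fun n => (hf.measurable n).aestronglyMeasurable.mul
        ((slice (hg.measurable n) (hg.bound n)).sub hsl).aestronglyMeasurable)
      (((hUp.norm.integral_prod_left.const_mul A).const_mul 2).const_mul A) (fun n => ?_) ?_
    · filter_upwards [slice_bound (hg.measurable n) (hg.bound n),
        slice_bound hg.measurable_lim hg.bound_lim] with x h1 h2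
      rw [norm_mul]
      have h0 : 0 ≤ A := (abs_nonneg _).trans (hf.bound n x)
      refine mul_le_mul (hf.bound n x) ?_ (norm_nonneg _) h0
      exact (norm_sub_le _ _).trans (by linarith)
    · filter_upwards [hpt] with x hx
      have hx0 : Tendsto (fun n => (∫ y, g n y * U (x, y)) - ∫ y, g' y * U (x, y)) atTop (𝓝 0) := by
        simpa using hx.sub_const (∫ y, g' y * U (x, y))
      exact bdd_le_mul_tendsto_zero' A (Eventually.of_forall fun n => hf.bound n x) hx0
  have hmain := (hf.tendsto _ hsl).add herr
  rw [add_zero, ← kernelForm_eq_integral_integral hU hf.measurable_lim hg.measurable_lim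
    hf.bound_lim hg.bound_lim] at hmain
  refine hmain.congr fun n => ?_
  rw [kernelForm_eq_integral_integral hU (hf.measurable n) (hg.measurable n) (hf.bound n)
    (hg.bound n), ← integral_add]
  · congr 1
    funext x
    ring
  · exact hsl.bdd_mul (hf.measurable n).aestronglyMeasurable
      (Eventually.of_forall fun x => hf.bound n x)
  · exact ((slice (hg.measurable n) (hg.bound n)).sub hsl).bdd_mul
      (hf.measurable n).aestronglyMeasurable (Eventually.of_forall fun x => hf.bound n x)

theorem BoundedWeakStarTendsto.tendsto_kernelForm_of_cutNorm {Un : ℕ → OpenUnit × OpenUnit → ℝ}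
    {U : OpenUnit × OpenUnit → ℝ} (hUn : ∀ n, Integrable (Un n) volume)
    (hU : Integrable U volume) (hcut : Tendsto (fun n => cutNorm (Un n - U)) atTop (𝓝 0))
    {A : ℝ} (hA : 0 < A) {f g : ℕ → OpenUnit → ℝ} {f' g' : OpenUnit → ℝ}
    (hf : BoundedWeakStarTendsto A f f') (hg : BoundedWeakStarTendsto A g g') :
    Tendsto (fun n => kernelForm (Un n) (f n) (g n)) atTop (𝓝 (kernelForm U f' g')) := by
  have h0 : Tendsto (fun n => kernelForm (Un n - U) (f n) (g n)) atTop (𝓝 0) := by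
    refine squeeze_zero_norm (fun n => abs_kernelForm_le_cutNorm ((hUn n).sub hU) (hf.measurable n)
      (hg.measurable n) hA (hf.bound n) (hg.bound n)) ?_
    simpa using hcut.const_mul (A ^ 2)
  have h := h0.add (hf.tendsto_kernelForm hU hg)
  rw [zero_add] at h
  refine h.congr fun n => ?_
  simp only [kernelForm]
  rw [← integral_add]
  · congr 1
    funext z
    simp only [Pi.sub_apply]
    ring
  · exact integrable_kernelForm ((hUn n).sub hU) (hf.measurable n) (hg.measurable n) (hf.bound n)
      (hg.bound n)
  · exact integrable_kernelForm hU (hf.measurable n) (hg.measurable n) (hf.bound n) (hg.bound n)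

/-! ### Moments and supports of narrow limits -/

/-- The function `x ↦ ∫ f dν_x`. -/
noncomputable def YoungMeasure.mean (ν : YoungMeasure) (f : ℝ →ᵇ ℝ) (x : OpenUnit) : ℝ :=
  ∫ l, f l ∂(ν.kernel x)

theorem YoungMeasure.measurable_mean (ν : YoungMeasure) (f : ℝ →ᵇ ℝ) : Measurable (ν.mean f) :=
  (f.continuous.stronglyMeasurable.integral_kernel (κ := ν.kernel)).measurable

theorem YoungMeasure.abs_mean_le (ν : YoungMeasure) (f : ℝ →ᵇ ℝ) (x : OpenUnit) :
    |ν.mean f x| ≤ ‖f‖ := by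
  simpa [mean] using f.norm_integral_le_norm (ν.kernel x)

theorem YoungMeasure.boundedWeakStarTendsto_mean {ν : ℕ → YoungMeasure} {ν' : YoungMeasure}
    (h : Tendsto ν atTop (𝓝 ν')) (f : ℝ →ᵇ ℝ) {A : ℝ} (hA : ‖f‖ ≤ A) :
    BoundedWeakStarTendsto A (fun n => (ν n).mean f) (ν'.mean f) where
  measurable n := (ν n).measurable_mean f
  measurable_lim := ν'.measurable_mean f
  bound n x := ((ν n).abs_mean_le f x).trans hA
  bound_lim x := (ν'.abs_mean_le f x).trans hA
  tendsto g hg := (tendsto_iff ν ν').1 h f g hg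

theorem YoungMeasure.ae_kernel_compl_eq_zero_of_tendsto {ν : ℕ → YoungMeasure} {ν' : YoungMeasure}
    (h : Tendsto ν atTop (𝓝 ν')) {K : Set ℝ} (hK : IsClosed K) (hne : K.Nonempty)
    (hν : ∀ n, ∀ᵐ x, (ν n).kernel x Kᶜ = 0) : ∀ᵐ x, ν'.kernel x Kᶜ = 0 := by
  -- A nonnegative `C_b` function vanishing exactly on `K`: its mean under a probability measure is
  -- zero iff that measure is carried by `K`.
  let f : ℝ →ᵇ ℝ := BoundedContinuousFunction.ofNormedAddCommGroup
    (fun l => min 1 (Metric.infDist l K)) (by fun_prop) 1 fun l => by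
      rw [Real.norm_of_nonneg (le_min zero_le_one Metric.infDist_nonneg)]
      exact min_le_left _ _
  have f_nonneg : ∀ l, 0 ≤ f l := fun l => le_min zero_le_one Metric.infDist_nonneg
  have f_zero : ∀ l, f l = 0 ↔ l ∈ K := by
    intro l
    rw [hK.mem_iff_infDist_zero hne]
    change min 1 (Metric.infDist l K) = 0 ↔ _
    rcases min_cases (1 : ℝ) (Metric.infDist l K) with ⟨h1, h2⟩ | ⟨h1, h2⟩ <;> rw [h1]
    constructor <;> intro h3 <;> linarith
  have key : ∀ (μ : YoungMeasure) (x : OpenUnit), μ.mean f x = 0 ↔ μ.kernel x Kᶜ = 0 := by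
    intro μ x
    rw [mean, integral_eq_zero_iff_of_nonneg f_nonneg (f.integrable _), ← mem_ae_iff]
    exact Filter.eventually_congr (Eventually.of_forall f_zero)
  have hlim := (tendsto_iff ν ν').1 h f (fun _ => 1) (integrable_const 1)
  have hzero : ∀ n, ∫ x, (∫ l, f l ∂((ν n).kernel x)) * (1 : ℝ) = 0 := by
    intro n
    refine integral_eq_zero_of_ae ?_
    filter_upwards [hν n] with x hx
    simpa [mean] using (key (ν n) x).2 hx
  simp only [hzero] at hlim
  have h0 : ∫ x, ν'.mean f x = 0 := by
    simpa [mean] using (tendsto_nhds_unique hlim tendsto_const_nhds)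
  have mean_nonneg : ∀ x, 0 ≤ ν'.mean f x := fun x => integral_nonneg f_nonneg
  rw [integral_eq_zero_iff_of_nonneg mean_nonneg] at h0
  · filter_upwards [h0] with x hx
    exact (key ν' x).1 hx
  · exact Integrable.of_bound (ν'.measurable_mean f).aestronglyMeasurable ‖f‖
      (Eventually.of_forall (ν'.abs_mean_le f))

/-! ### The Dirichlet energy as a sum of bilinear forms -/

/-- The projection of `ℝ` onto `[-M, M]`. -/
noncomputable def clamp (M : ℝ) : ℝ →ᵇ ℝ :=
  BoundedContinuousFunction.ofNormedAddCommGroup (fun l => max (-|M|) (min |M| l)) (by fun_prop) |M|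
    fun l => abs_le.2 ⟨le_max_left _ _,
      max_le (neg_le_self (abs_nonneg M)) (min_le_left _ _)⟩

theorem clamp_eq_self {M l : ℝ} (hl : l ∈ Icc (-M) M) : clamp M l = l := by
  have hM : |M| = M := abs_of_nonneg (by linarith [hl.1, hl.2])
  change max (-|M|) (min |M| l) = l
  rw [hM, min_eq_right hl.2, max_eq_right hl.1]

/-- The coordinate is not in `C_b(ℝ)`, but it agrees a.e. with its truncation, so the moments become
admissible narrow test functions. -/
theorem integral_sq_sub_prod {M : ℝ} {μ η : Measure ℝ} [IsProbabilityMeasure μ]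
    [IsProbabilityMeasure η] (hμ : μ (Icc (-M) M)ᶜ = 0) (hη : η (Icc (-M) M)ᶜ = 0) :
    Integrable (fun q : ℝ × ℝ => |q.1 - q.2| ^ 2) (μ.prod η) ∧
    ∫ q : ℝ × ℝ, |q.1 - q.2| ^ 2 ∂(μ.prod η) =
      (∫ l, (clamp M * clamp M) l ∂μ) - 2 * ((∫ l, clamp M l ∂μ) * ∫ l, clamp M l ∂η) +
        ∫ l, (clamp M * clamp M) l ∂η := by
  have e : (fun q : ℝ × ℝ => |q.1 - q.2| ^ 2) =ᵐ[μ.prod η] fun q =>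
      (clamp M * clamp M) q.1 - 2 * (clamp M q.1 * clamp M q.2) + (clamp M * clamp M) q.2 := by
    have h1 : ∀ᵐ q ∂(μ.prod η), q.1 ∈ Icc (-M) M :=
      Measure.quasiMeasurePreserving_fst.ae (mem_ae_iff.2 hμ)
    have h2 : ∀ᵐ q ∂(μ.prod η), q.2 ∈ Icc (-M) M :=
      Measure.quasiMeasurePreserving_snd.ae (mem_ae_iff.2 hη)
    filter_upwards [h1, h2] with q hq1 hq2
    rw [BoundedContinuousFunction.mul_apply, BoundedContinuousFunction.mul_apply,
      clamp_eq_self hq1, clamp_eq_self hq2, sq_abs]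
    ring
  have i1 : Integrable (fun q : ℝ × ℝ => (clamp M * clamp M) q.1) (μ.prod η) :=
    ((clamp M * clamp M).integrable μ).comp_fst η
  have i2 : Integrable (fun q : ℝ × ℝ => (clamp M * clamp M) q.2) (μ.prod η) :=
    ((clamp M * clamp M).integrable η).comp_snd μ
  have i3 : Integrable (fun q : ℝ × ℝ => 2 * (clamp M q.1 * clamp M q.2)) (μ.prod η) :=
    (((clamp M).integrable μ).mul_prod ((clamp M).integrable η)).const_mul 2
  have i4 : Integrable (fun q : ℝ × ℝ =>
      (clamp M * clamp M) q.1 - 2 * (clamp M q.1 * clamp M q.2)) (μ.prod η) := i1.sub i3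
  refine ⟨(i4.add i2).congr e.symm, ?_⟩
  rw [integral_congr_ae e, integral_add i4 i2, integral_sub i1 i3, integral_const_mul,
    integral_prod_mul, integral_fun_fst, integral_fun_snd]
  simp

theorem YoungMeasure.dirichlet_eq_kernelForm {M : ℝ} {ν : YoungMeasure}
    (hν : ∀ᵐ x, ν.kernel x (Icc (-M) M)ᶜ = 0) {U : OpenUnit × OpenUnit → ℝ}
    (hU : Integrable U volume) :
    DirichletIntegrable U ν ∧ graphonDirichlet U ν =
      kernelForm U (ν.mean (clamp M * clamp M)) (fun _ => 1)
        - 2 * kernelForm U (ν.mean (clamp M)) (ν.mean (clamp M))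
        + kernelForm U (fun _ => 1) (ν.mean (clamp M * clamp M)) := by
  have h1 : ∀ᵐ z : OpenUnit × OpenUnit, ν.kernel z.1 (Icc (-M) M)ᶜ = 0 :=
    Measure.quasiMeasurePreserving_fst.ae hν
  have h2 : ∀ᵐ z : OpenUnit × OpenUnit, ν.kernel z.2 (Icc (-M) M)ᶜ = 0 :=
    Measure.quasiMeasurePreserving_snd.ae hν
  have e : (fun z : OpenUnit × OpenUnit => U z * dirichletDensity ν z) =ᵐ[volume] fun z =>
      U z * ν.mean (clamp M * clamp M) z.1 * 1
        - 2 * (U z * ν.mean (clamp M) z.1 * ν.mean (clamp M) z.2)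
        + U z * 1 * ν.mean (clamp M * clamp M) z.2 := by
    filter_upwards [h1, h2] with z hz1 hz2
    rw [dirichletDensity, (integral_sq_sub_prod hz1 hz2).2]
    simp only [mean]
    ring
  let A := max 1 (max ‖clamp M‖ ‖clamp M * clamp M‖)
  have hA1 : ∀ x : OpenUnit, |(fun _ => (1 : ℝ)) x| ≤ A := fun x => by
    simp [A]
  have hAm : ∀ x, |ν.mean (clamp M) x| ≤ A := fun x =>
    (ν.abs_mean_le _ x).trans ((le_max_left _ _).trans (le_max_right _ _))
  have hAs : ∀ x, |ν.mean (clamp M * clamp M) x| ≤ A := fun x =>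
    (ν.abs_mean_le _ x).trans ((le_max_right _ _).trans (le_max_right _ _))
  have i1 := integrable_kernelForm hU (ν.measurable_mean (clamp M * clamp M)) measurable_const
    hAs hA1
  have i2 := (integrable_kernelForm hU (ν.measurable_mean (clamp M)) (ν.measurable_mean (clamp M))
    hAm hAm).const_mul 2
  have i3 := integrable_kernelForm hU measurable_const (ν.measurable_mean (clamp M * clamp M))
    hA1 hAs
  have i4 : Integrable (fun z : OpenUnit × OpenUnit => U z * ν.mean (clamp M * clamp M) z.1 * 1
      - 2 * (U z * ν.mean (clamp M) z.1 * ν.mean (clamp M) z.2)) volume := i1.sub i2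
  refine ⟨⟨?_, (i4.add i3).congr e.symm⟩, ?_⟩
  · filter_upwards [h1, h2] with z hz1 hz2
    exact (integral_sq_sub_prod hz1 hz2).1
  · rw [graphonDirichlet, integral_congr_ae e, integral_add i4 i3, integral_sub i1 i2,
      integral_const_mul]
    rfl

theorem YoungMeasure.tendsto_graphonDirichlet {Un : ℕ → OpenUnit × OpenUnit → ℝ}
    {U : OpenUnit × OpenUnit → ℝ} (hUn : ∀ n, Integrable (Un n) volume)
    (hU : Integrable U volume) (hcut : Tendsto (fun n => cutNorm (Un n - U)) atTop (𝓝 0))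
    {M : ℝ} {ν : ℕ → YoungMeasure} {ν' : YoungMeasure} (h : Tendsto ν atTop (𝓝 ν'))
    (hν : ∀ n, ∀ᵐ x, (ν n).kernel x (Icc (-M) M)ᶜ = 0)
    (hν' : ∀ᵐ x, ν'.kernel x (Icc (-M) M)ᶜ = 0) :
    Tendsto (fun n => graphonDirichlet (Un n) (ν n)) atTop (𝓝 (graphonDirichlet U ν')) := by
  simp only [(dirichlet_eq_kernelForm hν' hU).2, (dirichlet_eq_kernelForm (hν _) (hUn _)).2]
  -- One bound for the constant `1` and both moments; the `1` also makes it positive.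
  let A := max 1 (max ‖clamp M‖ ‖clamp M * clamp M‖)
  have hA : 0 < A := zero_lt_one.trans_le (le_max_left _ _)
  have c1 : BoundedWeakStarTendsto A (fun _ _ => 1) (fun _ => 1) :=
    ⟨fun _ => measurable_const, measurable_const, fun _ _ => by simp [A], fun _ => by simp [A],
      fun _ _ => tendsto_const_nhds⟩
  have cm := boundedWeakStarTendsto_mean h (clamp M) (A := A)
    ((le_max_left _ _).trans (le_max_right _ _))
  have cs := boundedWeakStarTendsto_mean h (clamp M * clamp M) (A := A)
    ((le_max_right _ _).trans (le_max_right _ _))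
  exact ((cs.tendsto_kernelForm_of_cutNorm hUn hU hcut hA c1).sub
    ((cm.tendsto_kernelForm_of_cutNorm hUn hU hcut hA cm).const_mul 2)).add
    (c1.tendsto_kernelForm_of_cutNorm hUn hU hcut hA cs)

theorem YoungMeasure.ofFun_kernel_compl_eq_zero {u : OpenUnit → ℝ} (hu : Measurable u) {K : Set ℝ}
    (hK : MeasurableSet K) (h : ∀ᵐ x, u x ∈ K) : ∀ᵐ x, (ofFun u hu).kernel x Kᶜ = 0 := by
  filter_upwards [h] with x hx
  simp [ofFun, Kernel.deterministic_apply' hu x hK.compl, hx]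

theorem YoungMeasure.graphonDirichlet_ofFun (U : OpenUnit × OpenUnit → ℝ) {u : OpenUnit → ℝ}
    (hu : Measurable u) : graphonDirichlet U (ofFun u hu) = ∫ z, U z * |u z.1 - u z.2| ^ 2 := by
  simp [graphonDirichlet, dirichletDensity, ofFun, Kernel.deterministic_apply,
    Measure.dirac_prod_dirac]


/-! ### The main theorem -/

theorem mainTheorem6 (p : ℝ≥0∞) (hp : 1 ≤ p)
    (Wn : ℕ → OpenUnit × OpenUnit → ℝ) (W : OpenUnit × OpenUnit → ℝ)
    (hWn : ∀ n, MemLp (Wn n) p volume) (hW : MemLp W p volume)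
    (hcut : Tendsto (fun n => cutNorm (Wn n - W)) atTop (𝓝 0))
    (u : ℕ → OpenUnit → ℝ) (hu : ∀ n, Measurable (u n))
    (hbdd : ⨆ n, eLpNorm (u n) ⊤ volume < ⊤) :
    -- the corresponding Young measures are precompact in the narrow topology
    IsCompact (closure (range fun n => YoungMeasure.ofFun (u n) (hu n))) ∧
    -- and every subsequence has a narrowly convergent further subsequence
    (∀ φ : ℕ → ℕ, StrictMono φ → ∃ ψ : ℕ → ℕ, StrictMono ψ ∧ ∃ ν : YoungMeasure,
      Tendsto (fun k => YoungMeasure.ofFun (u (φ (ψ k))) (hu (φ (ψ k)))) atTop (𝓝 ν)) ∧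
    -- the energies are well defined, and converge along every narrowly convergent subsequence
    (∀ n, DirichletIntegrable (Wn n) (YoungMeasure.ofFun (u n) (hu n))) ∧
    ∀ φ : ℕ → ℕ, StrictMono φ → ∀ ν : YoungMeasure,
      Tendsto (fun k => YoungMeasure.ofFun (u (φ k)) (hu (φ k))) atTop (𝓝 ν) →
      DirichletIntegrable W ν ∧
      Tendsto (fun k => graphonDirichlet (Wn (φ k)) (YoungMeasure.ofFun (u (φ k)) (hu (φ k))))
        atTop (𝓝 (graphonDirichlet W ν)) ∧
      ((∀ n, 1 ≤ n → u n ∈ graphFunctions n) →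
        Tendsto (fun k => graphDirichlet (φ k) (Wn (φ k)) (u (φ k))) atTop
          (𝓝 ((graphonDirichlet W ν : ℝ) : EReal))) := by
  have hWn1 : ∀ n, Integrable (Wn n) volume := fun n => (hWn n).integrable hp
  have hW1 : Integrable W volume := hW.integrable hp
  let M : ℝ := (⨆ n, eLpNorm (u n) ⊤ volume).toReal
  have hM : ∀ n, ∀ᵐ x, u n x ∈ Icc (-M) M := by
    intro n
    have hle := le_iSup (fun n => eLpNorm (u n) ⊤ volume) n
    filter_upwards [ae_le_eLpNormEssSup (f := u n) (μ := volume)] with x hx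
    rw [← eLpNorm_exponent_top] at hx
    have h := ENNReal.toReal_mono hbdd.ne (hx.trans hle)
    rw [toReal_enorm] at h
    exact abs_le.1 h
  have hM0 : 0 ≤ M := ENNReal.toReal_nonneg
  have hsupp : ∀ n, ∀ᵐ x, (YoungMeasure.ofFun (u n) (hu n)).kernel x (Icc (-M) M)ᶜ = 0 :=
    fun n => YoungMeasure.ofFun_kernel_compl_eq_zero (hu n) measurableSet_Icc (hM n)
  refine ⟨YoungMeasure.isCompact_closure_range isCompact_Icc hsupp,
    fun φ _ => YoungMeasure.exists_tendsto_subseq isCompact_Icc fun k => hsupp (φ k),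
    fun n => (YoungMeasure.dirichlet_eq_kernelForm (hsupp n) (hWn1 n)).1,
    fun φ hφ ν hν => ?_⟩
  have hνsupp := YoungMeasure.ae_kernel_compl_eq_zero_of_tendsto hν
    (isClosed_Icc (a := -M) (b := M)) ⟨0, by simpa using hM0⟩ fun k => hsupp (φ k)
  have hlim := YoungMeasure.tendsto_graphonDirichlet (fun k => hWn1 (φ k)) hW1
    (hcut.comp hφ.tendsto_atTop) hν (fun k => hsupp (φ k)) hνsupp
  refine ⟨(YoungMeasure.dirichlet_eq_kernelForm hνsupp hW1).1, hlim, fun hgraph => ?_⟩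
  refine ((continuous_coe_real_ereal.tendsto _).comp hlim).congr' ?_
  -- `φ 0` may be `0`, where nothing is assumed about graph functions, so the energies are only
  -- eventually equal.
  filter_upwards [hφ.tendsto_atTop.eventually_ge_atTop 1] with k hk
  rw [graphDirichlet, if_pos (hgraph _ hk), Function.comp_apply,
    YoungMeasure.graphonDirichlet_ofFun]
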